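/- **Conventions.** Graphs are finite, simple and undirected. Let $k_1,k_2\in\mathbb N$ with $k_1+k_2\ge 1$, and let $[x_{k_1},y_{k_2}]=\{x_1,\dots,x_{k_1},y_1,\dots,y_{k_2}\}$. These symbols serve as searchers, pebbles and variables; the $x_i$ are reusable, the $y_j$ are not. **CFI graphs.** For a connected graph $G$ and $U\subseteq V(G)$ let $X_U(G)$ be the graph whose vertices are the pairs $(v,S)$ with $v\in V(G)$, $S$ a set of edges incident to $v$, and $|S|\equiv|\{v\}\cap U| \pmod 2$, where $(v,S)$ and $(u,T)$ are adjacent iff $uv\in E(G)$ and $uv\notin S\mathbin{\triangle}T$. Put $X(G)=X_\emptyset(G)$ and $\widetilde X(G)=X_{\{u\}}(G)$ for an arbitrary $u\in V(G)$. **Node searching game $\mathrm{NS}^{(k_1,k_2)}(G)$.** A position of the searchers is a partial function $\gamma$ from $[x_{k_1},y_{k_2}]$ to $V(G)$, initially empty. The fugitive is at a vertex, initially any vertex. In a round the searchers choose a searcher $z$ that is some $x_i$ or is not on the graph, and a destination $w\in V(G)\cup\{\bot\}$ ($\bot$ means off the graph). The fugitive, now at $v$, moves to a vertex $v'$ in the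 connected component of $v$ in $G-\operatorname{im}(\gamma[z/\bot])$ and is caught if $v'\in\operatorname{im}(\gamma[z/w])$; otherwise play continues from $(\gamma[z/w],v')$. The fugitive is invisible, so a strategy of the searchers is a finite legal sequence of moves fixed in advance; it wins if every play of the fugitive against it is caught. The fugitive wins if the searchers have no winning strategy, that is, if against every legal finite sequence of moves some play of the fugitive is never caught. **All-in-one bijective $(k_1,k_2)$-pebble game on graphs $A,B$.** There is one round. Spoiler chooses $\bar z=(z_1,\dots,z_n)\in[x_{k_1},y_{k_2}]^n$ in which each $y_j$ occurs at most once. Duplicator chooses a bijection $h\colon V(A)^n\to V(B)^n$. Spoiler chooses $\bar v\in V(A)^n$; let $\bar d=h(\bar v)$. Duplicator wins if for every $i\le n$ the assignment $v_j\mapsto d_j$, where $j$ ranges over those indices $j\le i$ for which $z_j$ does not occur among $z_{j+1},\dots,z_i$, is a well-defined partial isomorphism from $A$ to $B$. **The logic ${\land}\mathsf C^{(k_1,k_2)}$ on graphs.** There are further variables $w_1,w_2,\dots$. Non-counting formulas are built from the atoms $z=z'$, $E(z,z')$ with $z,z'\in[x_{k_1},y_{k_2}]$ and their negations by restricted finite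 conjunctions, restricted finite disjunctions, and $\exists z\,(z=w_\ell\land\psi)$ with $z\in[x_{k_1},y_{k_2}]$ and $w_\ell$ not free in $\psi$. Restricted means that at most one of the combined formulas both contains a quantifier and has a free variable. No $y_j$ may be requantified, i.e. occur both free and bound, or be quantified within the scope of a quantification over $y_j$. The sentences of the logic are the non-counting formulas without free variables, the sentences $\exists^{n}(w_{\ell_1},\dots,w_{\ell_m})\,\psi$ ("exactly $n$ tuples satisfy $\psi$") with $n,m\in\mathbb N$, distinct $w_{\ell_i}$ and a non-counting formula $\psi$ all of whose free variables are among the $w_{\ell_i}$, and finite disjunctions of sentences. Two graphs are ${\land}\mathsf C^{(k_1,k_2)}$-equivalent if they satisfy the same sentences. **Statement.** Let $G$ be a connected graph. If the fugitive wins $\mathrm{NS}^{(k_1,k_2)}(G)$, then Duplicator has a winning strategy in the all-in-one bijective $(k_1,k_2)$-pebble game on $X(G)$ and $\widetilde X(G)$. Moreover, $X(G)$ and $\widetilde X(G)$ are ${\land}\mathsf C^{(k_1,k_2)}$-equivalent. -/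

import Mathlib

namespace CFIGame

/-! ### CFI graphs -/

section CFI

variable {V : Type*}

/-- The vertices of `X_U(G)`: pairs `(v, S)` with `S ⊆ E(v)` and `|S| ≡ |{v} ∩ U| mod 2`. -/
def CFIVertex (G : SimpleGraph V) (U : Set V) : Type _ :=
  {p : V × Set (Sym2 V) //
    p.2 ⊆ G.incidenceSet p.1 ∧ p.2.ncard ≡ ({p.1} ∩ U : Set V).ncard [MOD 2]}

/-- The CFI graph `X_U(G)`: the pair `(v, S)`, `(u, T)` is an edge if `uv ∈ E(G)` and
`uv ∉ S ∆ T`. -/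
def cfiGraph (G : SimpleGraph V) (U : Set V) : SimpleGraph (CFIVertex G U) where
  Adj p q := G.Adj p.1.1 q.1.1 ∧ s(p.1.1, q.1.1) ∉ symmDiff p.1.2 q.1.2
  symm := ⟨fun p q h => ⟨h.1.symm, by rw [Sym2.eq_swap, symmDiff_comm]; exact h.2⟩⟩
  loopless := ⟨fun _ h => G.loopless.irrefl _ h.1⟩

end CFI

/-- Pebbles, searchers and variables: `Sum.inl i` is one of the reusable `x_1, …, x_{k₁}`,
`Sum.inr j` is one of the non-reusable `y_1, …, y_{k₂}`. -/
abbrev Pebble (k₁ k₂ : ℕ) : Type := Fin k₁ ⊕ Fin k₂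

/-! ### The node searching game -/

section NodeSearching

variable {V : Type*} {k₁ k₂ : ℕ}

/-- A position of the searchers, a partial function from searchers to vertices. -/
abbrev Position (V : Type*) (k₁ k₂ : ℕ) : Type _ := Pebble k₁ k₂ → Option V

/-- One move of the searchers: a searcher and its destination (`none` is off the graph). -/
abbrev Move (V : Type*) (k₁ k₂ : ℕ) : Type _ := Pebble k₁ k₂ × Option V

/-- The set of vertices that are occupied in the position `γ`. -/
def Position.im (γ : Position V k₁ k₂) : Set V := {v | ∃ z, γ z = some v}

/-- The vertices `v` and `v'` lie in the same connected component of `G - S`. -/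
def SameComponent (G : SimpleGraph V) (S : Set V) (v v' : V) : Prop :=
  ∃ (h : v ∈ Sᶜ) (h' : v' ∈ Sᶜ), (G.induce Sᶜ).Reachable ⟨v, h⟩ ⟨v', h'⟩

/-- A finite sequence of moves is legal from `γ` if a non-reusable searcher is moved only while it
is not on the graph. -/
def Legal : Position V k₁ k₂ → List (Move V k₁ k₂) → Prop
  | _, [] => True
  | γ, (z, w) :: ms =>
      (∀ j : Fin k₂, z = Sum.inr j → γ z = none) ∧ Legal (Function.update γ z w) ms

/-- A fugitive at `v` has a play that is not caught while the searchers, starting from `γ`, carry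
out the given moves. In each round the fugitive moves inside its component after the chosen
searcher has been lifted, and must not be on an occupied vertex once that searcher has landed. -/
def CanEvade (G : SimpleGraph V) : Position V k₁ k₂ → V → List (Move V k₁ k₂) → Prop
  | _, _, [] => True
  | γ, v, (z, w) :: ms =>
      ∃ v', SameComponent G (Position.im (Function.update γ z none)) v v' ∧
        v' ∉ Position.im (Function.update γ z w) ∧
        CanEvade G (Function.update γ z w) v' ms

/-- The searchers win `NS^(k₁,k₂)(G)`: as the fugitive is invisible, a strategy is a fixed legal
sequence of moves, and it wins if it catches every play of the fugitive. -/
def SearchersWin (G : SimpleGraph V) (k₁ k₂ : ℕ) : Prop :=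
  ∃ ms : List (Move V k₁ k₂), Legal (fun _ => none) ms ∧
    ∀ v : V, ¬ CanEvade G (fun _ => none) v ms

/-- The fugitive wins `NS^(k₁,k₂)(G)`: every strategy of the searchers can be evaded. -/
def FugitiveWins (G : SimpleGraph V) (k₁ k₂ : ℕ) : Prop :=
  ∀ ms : List (Move V k₁ k₂), Legal (fun _ => none) ms →
    ∃ v : V, CanEvade G (fun _ => none) v ms

theorem fugitiveWins_iff (G : SimpleGraph V) (k₁ k₂ : ℕ) :
    FugitiveWins G k₁ k₂ ↔ ¬ SearchersWin G k₁ k₂ := by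
  simp [FugitiveWins, SearchersWin]

end NodeSearching

/-! ### The all-in-one bijective pebble game -/

section PebbleGame

variable {A B : Type*} {k₁ k₂ : ℕ}

/-- The relation `r` is (the graph of) a partial isomorphism between `H` and `K`. -/
def IsPartialIso (H : SimpleGraph A) (K : SimpleGraph B) (r : A → B → Prop) : Prop :=
  ∀ a b a' b', r a b → r a' b' → (a = a' ↔ b = b') ∧ (H.Adj a a' ↔ K.Adj b b')

/-- Among the steps up to `i`, the step `j` is the last one at which the pebble `p` is placed. -/
def IsLast {n : ℕ} (z : Fin n → Pebble k₁ k₂) (i : Fin n) (p : Pebble k₁ k₂) (j : Fin n) : Prop :=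
  z j = p ∧ j ≤ i ∧ ∀ l, j < l → l ≤ i → z l ≠ p

/-- The correspondence `η_i` after step `i`: for each pebble that has been placed, its last
position in `v` is mapped to its last position in `d`. -/
def eta {n : ℕ} (z : Fin n → Pebble k₁ k₂) (v : Fin n → A) (d : Fin n → B) (i : Fin n)
    (a : A) (b : B) : Prop :=
  ∃ p j, IsLast z i p j ∧ a = v j ∧ b = d j

/-- Duplicator wins the all-in-one bijective `(k₁,k₂)`-pebble game on `H` and `K`. -/
def DuplicatorWins (k₁ k₂ : ℕ) (H : SimpleGraph A) (K : SimpleGraph B) : Prop :=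
  ∀ (n : ℕ) (z : Fin n → Pebble k₁ k₂),
    (∀ (j : Fin k₂) (i i' : Fin n), z i = Sum.inr j → z i' = Sum.inr j → i = i') →
    ∃ h : (Fin n → A) ≃ (Fin n → B),
      ∀ (v : Fin n → A) (i : Fin n), IsPartialIso H K (eta z v (h v) i)

end PebbleGame

/-! ### Counting logic with restricted conjunction and requantification -/

section Logic

variable {k₁ k₂ : ℕ}

/-- Atomic formulas over the signature of graphs. -/
inductive Atom (k₁ k₂ : ℕ) : Type
  | eq (z z' : Pebble k₁ k₂)
  | adj (z z' : Pebble k₁ k₂)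

/-- Raw non-counting formulas over the variables `x_1, …, x_{k₁}, y_1, …, y_{k₂}` and `w_ℓ`
for `ℓ ∈ ℕ`. The formula `ex z ℓ ψ` is `∃ z (z = w_ℓ ∧ ψ)`. -/
inductive NonCounting (k₁ k₂ : ℕ) : Type
  | pos (p : Atom k₁ k₂)
  | neg (p : Atom k₁ k₂)
  | disj {n : ℕ} (ψ : Fin n → NonCounting k₁ k₂)
  | conj {n : ℕ} (ψ : Fin n → NonCounting k₁ k₂)
  | ex (z : Pebble k₁ k₂) (l : ℕ) (ψ : NonCounting k₁ k₂)

/-- The variables of an atomic formula. -/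
def Atom.vars : Atom k₁ k₂ → Set (Pebble k₁ k₂)
  | .eq z z' => {z, z'}
  | .adj z z' => {z, z'}

namespace NonCounting

/-- The free variables among the `x_i` and `y_j`. -/
def freeZ : NonCounting k₁ k₂ → Set (Pebble k₁ k₂)
  | pos p => p.vars
  | neg p => p.vars
  | disj ψ => ⋃ i, (ψ i).freeZ
  | conj ψ => ⋃ i, (ψ i).freeZ
  | ex z _ ψ => ψ.freeZ \ {z}

/-- The free variables among the `w_ℓ`. -/
def freeW : NonCounting k₁ k₂ → Set ℕ
  | pos _ => ∅
  | neg _ => ∅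
  | disj ψ => ⋃ i, (ψ i).freeW
  | conj ψ => ⋃ i, (ψ i).freeW
  | ex _ l ψ => insert l ψ.freeW

/-- The quantified variables. -/
def bound : NonCounting k₁ k₂ → Set (Pebble k₁ k₂)
  | pos _ => ∅
  | neg _ => ∅
  | disj ψ => ⋃ i, (ψ i).bound
  | conj ψ => ⋃ i, (ψ i).bound
  | ex z _ ψ => insert z ψ.bound

/-- The formula has no free variables. -/
def Closed (φ : NonCounting k₁ k₂) : Prop := φ.freeZ = ∅ ∧ φ.freeW = ∅

/-- The variable `z` is quantified within the scope of a quantification over `z`. -/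
def Nested (z : Pebble k₁ k₂) : NonCounting k₁ k₂ → Prop
  | pos _ => False
  | neg _ => False
  | disj ψ => ∃ i, (ψ i).Nested z
  | conj ψ => ∃ i, (ψ i).Nested z
  | ex z' _ ψ => (z = z' ∧ z ∈ ψ.bound) ∨ ψ.Nested z

/-- The variable `z` is requantified. -/
def Requantified (z : Pebble k₁ k₂) (φ : NonCounting k₁ k₂) : Prop :=
  (z ∈ φ.freeZ ∧ z ∈ φ.bound) ∨ φ.Nested z

/-- A family of formulas is restricted if at most one of its members that contain a quantifier is
not a sentence. -/
def Restricted {n : ℕ} (ψ : Fin n → NonCounting k₁ k₂) : Prop :=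
  {i | (ψ i).bound.Nonempty ∧ ¬ (ψ i).Closed}.Subsingleton

/-- Every conjunction is restricted, and in every `∃ z (z = w_ℓ ∧ ψ)` the variable `w_ℓ` is not
free in `ψ`. -/
def ConjRestricted : NonCounting k₁ k₂ → Prop
  | pos _ => True
  | neg _ => True
  | disj ψ => ∀ i, (ψ i).ConjRestricted
  | conj ψ => Restricted ψ ∧ ∀ i, (ψ i).ConjRestricted
  | ex _ l ψ => l ∉ ψ.freeW ∧ ψ.ConjRestricted

/-- Every disjunction is restricted, in the same sense as for conjunctions. (Disjunctions of
sentences, see `Sentence.or`, are arbitrary.) Inside the scope of an exact counting quantifier an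
unrestricted disjunction would be as strong as an unrestricted conjunction, by
inclusion-exclusion. -/
def DisjRestricted : NonCounting k₁ k₂ → Prop
  | pos _ => True
  | neg _ => True
  | disj ψ => Restricted ψ ∧ ∀ i, (ψ i).DisjRestricted
  | conj ψ => ∀ i, (ψ i).DisjRestricted
  | ex _ _ ψ => ψ.DisjRestricted

/-- The non-counting formulas of the logic. -/
def Valid (φ : NonCounting k₁ k₂) : Prop :=
  φ.ConjRestricted ∧ φ.DisjRestricted ∧ ∀ j : Fin k₂, ¬ φ.Requantified (Sum.inr j)

end NonCounting

/-- Satisfaction of atomic formulas under a partial assignment. -/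
def Atom.Sat {A : Type*} (H : SimpleGraph A) (α : Pebble k₁ k₂ → Option A) : Atom k₁ k₂ → Prop
  | .eq z z' => ∃ a, α z = some a ∧ α z' = some a
  | .adj z z' => ∃ a b, α z = some a ∧ α z' = some b ∧ H.Adj a b

/-- Satisfaction of non-counting formulas under partial assignments `α` of the `x_i`, `y_j` and
`β` of the `w_ℓ`. -/
def NonCounting.Sat {A : Type*} (H : SimpleGraph A) (β : ℕ → Option A) :
    (Pebble k₁ k₂ → Option A) → NonCounting k₁ k₂ → Prop
  | α, .pos p => p.Sat H α
  | α, .neg p => ¬ p.Sat H α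
  | α, .disj ψ => ∃ i, (ψ i).Sat H β α
  | α, .conj ψ => ∀ i, (ψ i).Sat H β α
  | α, .ex z l ψ => ∃ a, β l = some a ∧ ψ.Sat H β (Function.update α z (some a))

/-- Raw sentences; `count n w ψ` is `∃^n (w_{ℓ_1}, …, w_{ℓ_m}) ψ`: there are exactly `n`
satisfying tuples. -/
inductive Sentence (k₁ k₂ : ℕ) : Type
  | nc (ψ : NonCounting k₁ k₂)
  | count (n : ℕ) {m : ℕ} (w : Fin m → ℕ) (ψ : NonCounting k₁ k₂)
  | or (φ φ' : Sentence k₁ k₂)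

namespace Sentence

/-- The sentences of the logic. -/
def Valid : Sentence k₁ k₂ → Prop
  | nc ψ => ψ.Valid ∧ ψ.Closed
  | count _ w ψ =>
      ψ.Valid ∧ Function.Injective w ∧ ψ.freeZ = ∅ ∧ ψ.freeW ⊆ Set.range w
  | or φ φ' => φ.Valid ∧ φ'.Valid

/-- Satisfaction of sentences. -/
def Sat {A : Type*} (H : SimpleGraph A) : Sentence k₁ k₂ → Prop
  | nc ψ => ψ.Sat H (fun _ => none) (fun _ => none)
  | count (m := m) n w ψ =>
      {v : Fin m → A |
        ψ.Sat H (Function.extend w (fun i => some (v i)) (fun _ => none)) (fun _ => none)}.encard = n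
  | or φ φ' => φ.Sat H ∨ φ'.Sat H

end Sentence

/-- The graphs `H` and `K` satisfy the same sentences of the logic. -/
def LogicEquiv {A B : Type*} (k₁ k₂ : ℕ) (H : SimpleGraph A) (K : SimpleGraph B) : Prop :=
  ∀ φ : Sentence k₁ k₂, φ.Valid → (φ.Sat H ↔ φ.Sat K)

end Logic

end CFIGame

namespace CFIGame

/-! ### Positions along a sequence of moves -/

section Moves

variable {A V : Type*} {k₁ k₂ : ℕ}

/-! The game is projected to $G$. Duplicator's bijection acts on whole tuples, so its value may
depend on the base vertices of all placements at once; this matches a fugitive who evades a search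
fixed in advance. Each projected tuple is a legal search, so some play escapes it. A walk from `u`
to the fugitive, with edges counted mod 2, gives a set $P$ having odd degree exactly at its ends.
Hence, at every vertex but the fugitive's, taking the symmetric difference with $P$ turns the parity
condition of $X(G)$ into that of $\widetilde X(G)$. The fugitive moves in $G$ minus the occupied
vertices, so $P$ never changes at a pebble that stays (`SameComponent.exists_hasEnds`,
`FugitiveWins.exists_twists`). All pebbles present are thus twisted by one common set, which
preserves equality and adjacency (`FugitiveWins.duplicatorWins`).

For the logic, the restrictions force the quantifiers of a non-counting formula into a chain
(`NonCounting.exists_trace`). The chain is a pebble sequence that Spoiler may choose, and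
Duplicator's bijection, extended to all counted coordinates, matches satisfying tuples
(`DuplicatorWins.logicEquiv`). -/

/-- The position after the first `i` of the given moves. -/
def Position.after (γ : Position V k₁ k₂) (ms : List (Move V k₁ k₂)) (i : ℕ) :
    Position V k₁ k₂ :=
  (ms.take i).foldl (fun γ m => Function.update γ m.1 m.2) γ

theorem Position.after_zero (γ : Position V k₁ k₂) (ms : List (Move V k₁ k₂)) :
    γ.after ms 0 = γ := by
  simp [Position.after]

theorem Position.after_cons_succ (γ : Position V k₁ k₂) (m : Move V k₁ k₂)
    (ms : List (Move V k₁ k₂)) (i : ℕ) :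
    γ.after (m :: ms) (i + 1) = Position.after (Function.update γ m.1 m.2) ms i := by
  simp [Position.after]

theorem Position.after_succ (γ : Position V k₁ k₂) (ms : List (Move V k₁ k₂)) (i : ℕ)
    (hi : i < ms.length) :
    γ.after ms (i + 1) = Function.update (γ.after ms i) ms[i].1 ms[i].2 := by
  rw [Position.after, List.take_succ_eq_append_getElem hi, List.foldl_append]
  rfl

/-- A play that is never caught, as a sequence of vertices. -/
theorem CanEvade.exists_play {G : SimpleGraph V} {γ : Position V k₁ k₂} {v : V}
    {ms : List (Move V k₁ k₂)} (h : CanEvade G γ v ms) :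
    ∃ f : ℕ → V, f 0 = v ∧ ∀ (i : ℕ) (hi : i < ms.length),
      SameComponent G (Position.im (Function.update (γ.after ms i) ms[i].1 none))
        (f i) (f (i + 1)) ∧ f (i + 1) ∉ Position.im (γ.after ms (i + 1)) := by
  induction ms generalizing γ v with
  | nil => exact ⟨fun _ => v, rfl, fun i hi => absurd hi (by simp)⟩
  | cons m ms ih =>
    obtain ⟨v', h₁, h₂, h₃⟩ := h
    obtain ⟨f, hf, h⟩ := ih h₃
    refine ⟨fun i => Nat.casesOn i v f, rfl, fun i hi => ?_⟩
    cases i with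
    | zero =>
      simp only [Position.after_zero, Position.after_cons_succ, hf]
      exact ⟨h₁, h₂⟩
    | succ i =>
      simp only [Position.after_cons_succ]
      exact h i (by simpa using hi)

/-- A non-reusable searcher that occurs only once is still off the graph when its turn comes. The
hypothesis `hγ` is the invariant that carries the induction. -/
theorem legal_of_pairwise {γ : Position V k₁ k₂} {ms : List (Move V k₁ k₂)}
    (h : ms.Pairwise fun m m' => ∀ j : Fin k₂, m.1 = Sum.inr j → m'.1 ≠ Sum.inr j)
    (hγ : ∀ j : Fin k₂, γ (Sum.inr j) = none ∨ ∀ m ∈ ms, m.1 ≠ Sum.inr j) : Legal γ ms := by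
  induction ms generalizing γ with
  | nil => trivial
  | cons m ms ih =>
    rw [List.pairwise_cons] at h
    refine ⟨fun j hj => ?_, ih h.2 fun j => ?_⟩
    · rcases hγ j with h' | h'
      · exact hj ▸ h'
      · exact absurd hj (h' m (by simp))
    · by_cases hm : m.1 = Sum.inr j
      · exact .inr fun m' hm' => h.1 m' hm' j hm
      · rw [Function.update_of_ne (Ne.symm hm)]
        exact (hγ j).imp_right fun h' m' hm' => h' m' (List.mem_cons_of_mem _ hm')

/-- The moves that place the pebbles `z` on the vertices `v`, one after the other. -/
def placements {n : ℕ} (z : Fin n → Pebble k₁ k₂) (v : Fin n → A) : List (Move A k₁ k₂) :=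
  List.ofFn fun i => (z i, some (v i))

theorem after_placements_succ {n : ℕ} (z : Fin n → Pebble k₁ k₂) (v : Fin n → A)
    (γ : Position A k₁ k₂) (i : Fin n) :
    γ.after (placements z v) (i + 1) =
      Function.update (γ.after (placements z v) i) (z i) (some (v i)) := by
  rw [Position.after_succ _ _ _ (by simp [placements])]
  simp [placements]

/-- Identifies search positions with the correspondences `eta` of the pebble game. Step `i` counts
from zero, so it is the position after `i + 1` moves. -/
theorem after_placements_eq_some_iff {n : ℕ} (z : Fin n → Pebble k₁ k₂) (v : Fin n → A)
    (i : Fin n) (p : Pebble k₁ k₂) (a : A) :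
    Position.after (fun _ => none) (placements z v) (i + 1) p = some a ↔
      ∃ j, IsLast z i p j ∧ a = v j := by
  obtain ⟨i, hi⟩ := i
  induction i with
  | zero =>
    rw [after_placements_succ z v _ ⟨0, hi⟩, Position.after_zero]
    by_cases hp : p = z ⟨0, hi⟩
    · subst hp
      simp only [Function.update_self, Option.some.injEq]
      constructor
      · rintro rfl
        exact ⟨⟨0, hi⟩, ⟨rfl, le_rfl, fun l h₁ h₂ => absurd h₁ (not_lt.2 h₂)⟩, rfl⟩
      · rintro ⟨j, ⟨-, hj, -⟩, rfl⟩
        congr 1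
        exact (le_antisymm hj (Nat.zero_le _)).symm
    · simp only [Function.update_of_ne hp, reduceCtorEq, false_iff]
      rintro ⟨j, ⟨hj', hj, -⟩, rfl⟩
      rw [le_antisymm hj (Nat.zero_le _)] at hj'
      exact hp hj'.symm
  | succ i ih =>
    rw [after_placements_succ z v _ ⟨i + 1, hi⟩]
    by_cases hp : p = z ⟨i + 1, hi⟩
    · subst hp
      simp only [Function.update_self, Option.some.injEq]
      constructor
      · rintro rfl
        exact ⟨⟨i + 1, hi⟩, ⟨rfl, le_rfl, fun l h₁ h₂ => absurd h₁ (not_lt.2 h₂)⟩, rfl⟩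
      · rintro ⟨j, ⟨-, hj, hl⟩, rfl⟩
        rcases hj.eq_or_lt with rfl | hlt
        · rfl
        · exact absurd rfl (hl _ hlt le_rfl)
    · rw [Function.update_of_ne hp]
      refine (ih (Nat.lt_of_succ_lt hi)).trans (exists_congr fun j => and_congr_left fun _ => ?_)
      constructor
      · rintro ⟨rfl, hj, hl⟩
        refine ⟨rfl, hj.trans (Nat.le_succ i), fun l h₁ h₂ => ?_⟩
        rcases h₂.eq_or_lt with rfl | hlt
        · exact Ne.symm hp
        · exact hl l h₁ (Nat.le_of_lt_succ hlt)
      · rintro ⟨rfl, hj, hl⟩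
        refine ⟨rfl, ?_, fun l h₁ h₂ => hl l h₁ (le_trans h₂ (Nat.le_succ i))⟩
        rcases hj.eq_or_lt with rfl | hlt
        · exact absurd rfl hp
        · exact Nat.le_of_lt_succ hlt

end Moves

/-! ### Twisting along paths -/

section Twist

variable {V : Type*} [Finite V] {k₁ k₂ : ℕ}

theorem ncard_symmDiff_zmod_two {X : Type*} [Finite X] (S T : Set X) :
    ((symmDiff S T).ncard : ZMod 2) = S.ncard + T.ncard := by
  have h₁ : (symmDiff S T).ncard = (S \ T).ncard + (T \ S).ncard :=
    Set.ncard_union_eq (Set.disjoint_left.2 fun x hx hx' => hx.2 hx'.1)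
  have h₂ := Set.ncard_inter_add_ncard_sdiff_eq_ncard S T
  have h₃ := Set.ncard_inter_add_ncard_sdiff_eq_ncard T S
  rw [Set.inter_comm] at h₃
  rw [h₁, ← h₂, ← h₃]
  push_cast
  linear_combination -(CharTwo.add_self_eq_zero ((S ∩ T).ncard : ZMod 2))

/-- The degree of `a` in the edge set `Q` is odd exactly at the ends `v ≠ v'` of a path. -/
def HasEnds (G : SimpleGraph V) (v v' : V) (Q : Set (Sym2 V)) : Prop :=
  ∀ a, ((Q ∩ G.incidenceSet a).ncard : ZMod 2) =
    ({a} ∩ {v} : Set V).ncard + ({a} ∩ {v'} : Set V).ncard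

/-- Concatenation of walks: the two contributions at `v'` cancel mod 2. -/
theorem HasEnds.symmDiff {G : SimpleGraph V} {v v' v'' : V} {Q Q' : Set (Sym2 V)}
    (h : HasEnds G v v' Q) (h' : HasEnds G v' v'' Q') : HasEnds G v v'' (symmDiff Q Q') := by
  intro a
  rw [Set.inter_comm, Set.inter_symmDiff_distrib_left, ncard_symmDiff_zmod_two,
    Set.inter_comm _ Q, Set.inter_comm _ Q', h a, h' a]
  linear_combination CharTwo.add_self_eq_zero (({a} ∩ {v'} : Set V).ncard : ZMod 2)

omit [Finite V] in
theorem HasEnds.edge {G : SimpleGraph V} {v v' : V} (h : G.Adj v v') :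
    HasEnds G v v' {s(v, v')} := by
  classical
  intro a
  have key : ∀ {X : Type _} (x : X) (S : Set X),
      (({x} ∩ S : Set X).ncard : ZMod 2) = if x ∈ S then 1 else 0 := by
    intro X x S
    split_ifs with hx
    · rw [Set.inter_eq_left.2 (by simpa using hx)]; simp
    · rw [Set.singleton_inter_eq_empty.2 hx]; simp
  rw [key, key, key]
  by_cases h₁ : a = v <;> by_cases h₂ : a = v'
  · exact absurd (h₁.symm.trans h₂) h.ne
  all_goals simp_all [SimpleGraph.incidenceSet]

omit [Finite V] in
theorem HasEnds.refl (G : SimpleGraph V) (v : V) : HasEnds G v v ∅ := by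
  intro a
  simp [CharTwo.add_self_eq_zero]

/-- A walk avoiding `S` uses no edge incident to `S`, so twisting along it is invisible at the
occupied vertices. -/
theorem SameComponent.exists_hasEnds {G : SimpleGraph V} {S : Set V} {v v' : V}
    (h : SameComponent G S v v') :
    ∃ Q, HasEnds G v v' Q ∧ ∀ a ∈ S, Q ∩ G.incidenceSet a = ∅ := by
  obtain ⟨hv, hv', hr⟩ := h
  rw [SimpleGraph.reachable_iff_reflTransGen] at hr
  generalize hx : (⟨v', hv'⟩ : (Sᶜ : Set V)) = x at hr
  obtain rfl : v' = x.1 := by rw [← hx]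
  clear hx hv'
  induction hr with
  | refl => exact ⟨∅, HasEnds.refl G _, fun a _ => Set.empty_inter _⟩
  | @tail x y _ hxy ih =>
    obtain ⟨Q, hQ, hQ'⟩ := ih
    have hxy' : G.Adj x.1 y.1 := hxy
    refine ⟨_, hQ.symmDiff (HasEnds.edge hxy'), fun a ha => ?_⟩
    have : s(x.1, y.1) ∉ G.incidenceSet a := by
      rintro ⟨-, h⟩
      rcases Sym2.mem_iff.1 h with h | h
      exacts [x.2 (h ▸ ha), y.2 (h ▸ ha)]
    rw [Set.inter_comm, Set.inter_symmDiff_distrib_left, Set.inter_comm _ Q, hQ' a ha,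
      Set.inter_singleton_eq_empty.2 this]
    exact symmDiff_self _

/-- If the fugitive wins, then for every sequence of placements there are edge sets that move the
twist away from the pebbled vertices without changing it at the remaining pebbles. -/
theorem FugitiveWins.exists_twists {G : SimpleGraph V} (hG : G.Connected)
    (hfug : FugitiveWins G k₁ k₂) (u : V) {n : ℕ} (z : Fin n → Pebble k₁ k₂)
    (hz : ∀ (j : Fin k₂) (i i' : Fin n), z i = Sum.inr j → z i' = Sum.inr j → i = i')
    (w : Fin n → V) :
    ∃ P : Fin n → Set (Sym2 V),
      (∀ i, ((P i ∩ G.incidenceSet (w i)).ncard : ZMod 2) = ({w i} ∩ {u} : Set V).ncard) ∧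
      ∀ i p j, IsLast z i p j → P i ∩ G.incidenceSet (w j) = P j ∩ G.incidenceSet (w j) := by
  have hlegal : Legal (fun _ => none) (placements z w) := by
    refine legal_of_pairwise ?_ fun _ => .inl rfl
    rw [placements, List.pairwise_ofFn]
    exact fun i i' hlt j hi hi' => hlt.ne (hz j i i' hi hi')
  obtain ⟨v, hv⟩ := hfug _ hlegal
  obtain ⟨f, -, hf⟩ := hv.exists_play
  replace hf : ∀ i : Fin n, SameComponent G (Position.im (Function.update
      (Position.after (fun _ => none) (placements z w) i) (z i) none)) (f i) (f (i + 1)) ∧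
      f (i + 1) ∉ Position.im (Position.after (fun _ => none) (placements z w) (i + 1)) := by
    intro i
    have := hf i (by simp [placements])
    simpa [placements] using this
  -- Before the first placement nothing is occupied, so any walk from `u` to the fugitive's start
  -- will do.
  obtain ⟨Q₀, hQ₀⟩ : ∃ Q, HasEnds G u (f 0) Q := by
    obtain ⟨p⟩ := hG.preconnected u (f 0)
    generalize f 0 = x at p
    induction p with
    | nil => exact ⟨∅, HasEnds.refl G _⟩
    | cons h p ih =>
      obtain ⟨Q, hQ⟩ := ih
      exact ⟨_, (HasEnds.edge h).symmDiff hQ⟩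
  choose Q hQ hQ' using fun i => (hf i).1.exists_hasEnds
  -- The mod 2 sum of `Q₀` and the walks of the first `i` rounds; the value `∅` beyond `n` only
  -- makes the recursion total.
  let P : ℕ → Set (Sym2 V) := fun i => Nat.rec Q₀
    (fun i S => symmDiff S (if h : i < n then Q ⟨i, h⟩ else ∅)) i
  have hP : ∀ i : Fin n, P (i + 1) = symmDiff (P i) (Q i) := fun i => by simp [P]
  have hends : ∀ i ≤ n, HasEnds G u (f i) (P i) := by
    intro i
    induction i with
    | zero => exact fun _ => hQ₀
    | succ i ih =>
      intro hi
      rw [hP ⟨i, hi⟩]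
      exact (ih (Nat.le_of_succ_le hi)).symmDiff (hQ ⟨i, hi⟩)
  refine ⟨fun i => P (i + 1), fun i => ?_, ?_⟩
  -- The far end `f (i + 1)` contributes nothing at `w i`: the fugitive is not caught there by the
  -- searcher that has just landed.
  · rw [hends (i + 1) i.2 (w i), show ({w i} ∩ {f (i + 1)} : Set V) = ∅ from Set.singleton_inter_eq_empty.2 ?_]
    · simp
    · intro h
      refine (hf i).2 ⟨z i, ?_⟩
      rw [after_placements_succ, Function.update_self, Set.mem_singleton_iff.1 h]
  · rintro ⟨i, hi⟩ p j hj
    induction i with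
    | zero => rw [le_antisymm hj.2.1 (Nat.zero_le _)]
    | succ i ih =>
      rcases hj.2.1.eq_or_lt with rfl | hlt
      · rfl
      have hj' : IsLast z ⟨i, Nat.lt_of_succ_lt hi⟩ p j :=
        ⟨hj.1, Nat.le_of_lt_succ hlt, fun l h₁ h₂ => hj.2.2 l h₁ (le_trans h₂ (Nat.le_succ i))⟩
      rw [← ih _ hj']
      change P (i + 1 + 1) ∩ _ = P (i + 1) ∩ _
      rw [hP ⟨i + 1, hi⟩, Set.inter_comm, Set.inter_symmDiff_distrib_left,
        Set.inter_comm _ (Q _), hQ']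
      · simp [Set.inter_comm]
      -- The pebble `p` is not the one being lifted, so `w j` is still occupied while the fugitive
      -- moves and `Q` avoids it.
      · refine ⟨p, ?_⟩
        rw [Function.update_of_ne (hj.2.2 _ hlt le_rfl).symm]
        exact (after_placements_eq_some_iff z w ⟨i, _⟩ p _).2 ⟨j, hj', rfl⟩

/-- Twisting a vertex of a CFI graph by an edge set. -/
def CFIVertex.twist {G : SimpleGraph V} {U U' : Set V} (P : Set (Sym2 V)) (x : CFIVertex G U)
    (h : ((P ∩ G.incidenceSet x.1.1).ncard : ZMod 2) =
      ({x.1.1} ∩ U : Set V).ncard + ({x.1.1} ∩ U' : Set V).ncard) : CFIVertex G U' :=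
  ⟨(x.1.1, symmDiff x.1.2 (P ∩ G.incidenceSet x.1.1)), by
    refine ⟨fun e he => ?_, ?_⟩
    · rcases he with he | he
      exacts [x.2.1 he.1, he.1.2]
    · have hx := (ZMod.natCast_eq_natCast_iff _ _ _).2 x.2.2
      rw [← ZMod.natCast_eq_natCast_iff, ncard_symmDiff_zmod_two, h, hx]
      linear_combination CharTwo.add_self_eq_zero (({x.1.1} ∩ U : Set V).ncard : ZMod 2)⟩

theorem FugitiveWins.duplicatorWins {G : SimpleGraph V} (hG : G.Connected)
    (hfug : FugitiveWins G k₁ k₂) (u : V) :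
    DuplicatorWins k₁ k₂ (cfiGraph G ∅) (cfiGraph G {u}) := by
  intro n z hz
  choose P hP hP' using hfug.exists_twists hG u z hz
  -- The sets `P` depend only on base vertices, which twisting preserves, so twisting again by the
  -- same sets is the inverse.
  let h : (Fin n → CFIVertex G ∅) ≃ (Fin n → CFIVertex G {u}) :=
    { toFun := fun v i => (v i).twist (P (fun l => (v l).1.1) i)
        (by simpa using hP (fun l => (v l).1.1) i)
      invFun := fun v i => (v i).twist (P (fun l => (v l).1.1) i)
        (by simpa using hP (fun l => (v l).1.1) i)
      left_inv := fun v => funext fun i =>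
        Subtype.ext (Prod.ext rfl (symmDiff_symmDiff_cancel_right _ _))
      right_inv := fun v => funext fun i =>
        Subtype.ext (Prod.ext rfl (symmDiff_symmDiff_cancel_right _ _)) }
  refine ⟨h, fun v i => ?_⟩
  -- Each visible pebble was twisted at its own step `j`, but the set of the current step `i` has
  -- the same effect on it.
  have key : ∀ p j, IsLast z i p j → (h v j).1 = ((v j).1.1,
      symmDiff (v j).1.2 (P (fun l => (v l).1.1) i ∩ G.incidenceSet (v j).1.1)) := by
    intro p j hj
    rw [hP' (fun l => (v l).1.1) i p j hj]
    rfl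
  rintro a b a' b' ⟨p, j, hj, rfl, rfl⟩ ⟨p', j', hj', rfl, rfl⟩
  have hext : ∀ {U : Set V} (x y : CFIVertex G U), x = y ↔ x.1.1 = y.1.1 ∧ x.1.2 = y.1.2 :=
    fun x y => Subtype.ext_iff.trans Prod.ext_iff
  rw [hext, hext]
  simp only [cfiGraph, key p j hj, key p' j' hj']
  generalize P (fun l => (v l).1.1) i = R
  generalize v j = x
  generalize v j' = y
  refine ⟨and_congr_right fun h => ?_, and_congr_right fun hxy => ?_⟩
  · rw [h]
    exact symmDiff_left_inj.symm
  -- The edge between the base vertices is incident to both, so `R` flips its membership in both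
  -- sets or in neither, and their symmetric difference keeps it or omits it as before.
  · have h₁ : s(x.1.1, y.1.1) ∈ G.incidenceSet x.1.1 := by
      simpa [SimpleGraph.incidenceSet] using hxy
    have h₂ : s(x.1.1, y.1.1) ∈ G.incidenceSet y.1.1 := by
      simpa [SimpleGraph.incidenceSet] using hxy
    simp only [Set.mem_symmDiff, Set.mem_inter_iff, h₁, h₂, and_true]
    tauto

end Twist

/-! ### Formulas along a play -/

section Logic

variable {A B : Type*} {k₁ k₂ : ℕ}

/-- Two partial assignments with the same domain that form a partial isomorphism. -/
def Compatible (H : SimpleGraph A) (K : SimpleGraph B) (α : Pebble k₁ k₂ → Option A)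
    (α' : Pebble k₁ k₂ → Option B) : Prop :=
  (∀ p, α p = none ↔ α' p = none) ∧
    IsPartialIso H K fun a b => ∃ p, α p = some a ∧ α' p = some b

theorem Compatible.sat_iff {H : SimpleGraph A} {K : SimpleGraph B} {α : Pebble k₁ k₂ → Option A}
    {α' : Pebble k₁ k₂ → Option B} (h : Compatible H K α α') (p : Atom k₁ k₂) :
    p.Sat H α ↔ p.Sat K α' := by
  have aux : ∀ z, (α z = none ∧ α' z = none) ∨ ∃ a b, α z = some a ∧ α' z = some b := by
    intro z
    have := h.1 z
    rcases e : α z with _ | a <;> rcases e' : α' z with _ | b <;> simp_all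
  cases p with
  | eq z z' =>
    rcases aux z with ⟨h₁, h₂⟩ | ⟨a, b, h₁, h₂⟩ <;>
      rcases aux z' with ⟨h₁', h₂'⟩ | ⟨a', b', h₁', h₂'⟩ <;> simp [Atom.Sat, *]
    have := (h.2 a b a' b' ⟨z, h₁, h₂⟩ ⟨z', h₁', h₂'⟩).1
    rw [eq_comm, this, eq_comm]
  | adj z z' =>
    rcases aux z with ⟨h₁, h₂⟩ | ⟨a, b, h₁, h₂⟩ <;>
      rcases aux z' with ⟨h₁', h₂'⟩ | ⟨a', b', h₁', h₂'⟩ <;> simp [Atom.Sat, *]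
    exact (h.2 a b a' b' ⟨z, h₁, h₂⟩ ⟨z', h₁', h₂'⟩).2

/-- The assignments stay compatible while the quantifications in the list are carried out. -/
def CompatibleAlong (H : SimpleGraph A) (K : SimpleGraph B) (β : ℕ → Option A) (β' : ℕ → Option B) :
    (Pebble k₁ k₂ → Option A) → (Pebble k₁ k₂ → Option B) → List (Pebble k₁ k₂ × ℕ) → Prop
  | α, α', [] => Compatible H K α α'
  | α, α', (z, l) :: t => Compatible H K α α' ∧ ∃ a b, β l = some a ∧ β' l = some b ∧
      CompatibleAlong H K β β' (Function.update α z (some a)) (Function.update α' z (some b)) t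

theorem CompatibleAlong.compatible {H : SimpleGraph A} {K : SimpleGraph B} {β : ℕ → Option A}
    {β' : ℕ → Option B} {α : Pebble k₁ k₂ → Option A} {α' : Pebble k₁ k₂ → Option B}
    {t : List (Pebble k₁ k₂ × ℕ)} (h : CompatibleAlong H K β β' α α' t) :
    Compatible H K α α' := by
  cases t with
  | nil => exact h
  | cons m t => exact h.1

/-! ### Quantifier chains of non-counting formulas. -/

namespace NonCounting

/-- Nothing inside a non-counting formula binds a `w`, so a formula with a quantifier is never
closed. Hence `Restricted` allows at most one member with quantifiers. -/
theorem freeW_nonempty_of_bound_nonempty (ψ : NonCounting k₁ k₂) (h : ψ.bound.Nonempty) :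
    ψ.freeW.Nonempty := by
  induction ψ with
  | pos p => exact absurd h Set.not_nonempty_empty
  | neg p => exact absurd h Set.not_nonempty_empty
  | disj ψ ih =>
    obtain ⟨i, hi⟩ := Set.nonempty_iUnion.1 h
    exact Set.nonempty_iUnion.2 ⟨i, ih i hi⟩
  | conj ψ ih =>
    obtain ⟨i, hi⟩ := Set.nonempty_iUnion.1 h
    exact Set.nonempty_iUnion.2 ⟨i, ih i hi⟩
  | ex z l ψ ih => exact Set.insert_nonempty _ _

/-- The quantifications of the formula in the order of their scopes, when they form a chain. -/
structure IsTrace (ψ : NonCounting k₁ k₂) (t : List (Pebble k₁ k₂ × ℕ)) : Prop where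
  mem_bound : ∀ m ∈ t, m.1 ∈ ψ.bound
  mem_freeW : ∀ m ∈ t, m.2 ∈ ψ.freeW
  pairwise : t.Pairwise fun m m' => m.2 ≠ m'.2 ∧ (m.1 = m'.1 → ψ.Nested m.1)

/-- Along the trace, compatible assignments cannot be distinguished by the formula. -/
def Determines.{v} (ψ : NonCounting k₁ k₂) (t : List (Pebble k₁ k₂ × ℕ)) : Prop :=
  ∀ {A B : Type v} (H : SimpleGraph A) (K : SimpleGraph B) (β : ℕ → Option A)
    (β' : ℕ → Option B) (α : Pebble k₁ k₂ → Option A) (α' : Pebble k₁ k₂ → Option B),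
    CompatibleAlong H K β β' α α' t → (ψ.Sat H β α ↔ ψ.Sat K β' α')

theorem IsTrace.mono {ψ φ : NonCounting k₁ k₂} {t : List (Pebble k₁ k₂ × ℕ)} (h : ψ.IsTrace t)
    (hb : ψ.bound ⊆ φ.bound) (hw : ψ.freeW ⊆ φ.freeW) (hn : ∀ z, ψ.Nested z → φ.Nested z) :
    φ.IsTrace t :=
  ⟨fun m hm => hb (h.mem_bound m hm), fun m hm => hw (h.mem_freeW m hm),
    h.pairwise.imp fun ⟨h₁, h₂⟩ => ⟨h₁, fun e => hn _ (h₂ e)⟩⟩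

/-- The trace of the only member with quantifiers serves for all: the others have an empty trace and
need only compatibility at the start. -/
theorem exists_common_trace.{v} {n : ℕ} {ψ : Fin n → NonCounting k₁ k₂} (hψ : Restricted ψ)
    (ih : ∀ i, ∃ t, (ψ i).IsTrace t ∧ Determines.{v} (ψ i) t) :
    ∃ t, (t = [] ∨ ∃ i, (ψ i).IsTrace t) ∧ ∀ i, Determines.{v} (ψ i) t := by
  choose t ht hd using ih
  have hnil : ∀ i, (ψ i).bound = ∅ → t i = [] := fun i hi =>
    List.eq_nil_iff_forall_not_mem.2 fun m hm => by simpa [hi] using (ht i).mem_bound m hm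
  by_cases h : ∃ i, (ψ i).bound.Nonempty
  · obtain ⟨i, hi⟩ := h
    refine ⟨t i, .inr ⟨i, ht i⟩, fun j => ?_⟩
    have hc : ∀ i, (ψ i).bound.Nonempty → ¬ (ψ i).Closed := fun i hi hcl =>
      (freeW_nonempty_of_bound_nonempty _ hi).ne_empty hcl.2
    rcases (ψ j).bound.eq_empty_or_nonempty with hj | hj
    · intro A B H K β β' α α' hα
      exact hd j H K β β' α α' (hnil j hj ▸ hα.compatible)
    · rw [hψ ⟨hi, hc i hi⟩ ⟨hj, hc j hj⟩]
      exact @hd j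
  · simp only [not_exists, Set.not_nonempty_iff_eq_empty] at h
    exact ⟨[], .inl rfl, fun i => hnil i (h i) ▸ hd i⟩

theorem isTrace_nil (ψ : NonCounting k₁ k₂) : ψ.IsTrace [] :=
  ⟨by simp, by simp, List.Pairwise.nil⟩

/-- By the restrictions on conjunctions and disjunctions, the quantifiers form a chain. -/
theorem exists_trace.{v} (ψ : NonCounting k₁ k₂) (hc : ψ.ConjRestricted) (hd : ψ.DisjRestricted) :
    ∃ t, ψ.IsTrace t ∧ Determines.{v} ψ t := by
  induction ψ with
  | pos p => exact ⟨[], isTrace_nil _, fun _ _ _ _ _ _ h => h.compatible.sat_iff p⟩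
  | neg p => exact ⟨[], isTrace_nil _, fun _ _ _ _ _ _ h => not_congr (h.compatible.sat_iff p)⟩
  | disj ψ ih =>
    obtain ⟨t, ht, h⟩ := exists_common_trace hd.1 fun i => ih i (hc i) (hd.2 i)
    refine ⟨t, ?_, fun H K β β' α α' hα => exists_congr fun i => h i H K β β' α α' hα⟩
    rcases ht with rfl | ⟨i, ht⟩
    · exact isTrace_nil _
    · exact ht.mono (Set.subset_iUnion (fun i => (ψ i).bound) i)
        (Set.subset_iUnion (fun i => (ψ i).freeW) i) fun z hz => ⟨i, hz⟩
  | conj ψ ih =>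
    obtain ⟨t, ht, h⟩ := exists_common_trace hc.1 fun i => ih i (hc.2 i) (hd i)
    refine ⟨t, ?_, fun H K β β' α α' hα => forall_congr' fun i => h i H K β β' α α' hα⟩
    rcases ht with rfl | ⟨i, ht⟩
    · exact isTrace_nil _
    · exact ht.mono (Set.subset_iUnion (fun i => (ψ i).bound) i)
        (Set.subset_iUnion (fun i => (ψ i).freeW) i) fun z hz => ⟨i, hz⟩
  | ex z l ψ ih =>
    obtain ⟨t, ht, h⟩ := ih hc.2 hd
    refine ⟨(z, l) :: t, ⟨?_, ?_, ?_⟩, ?_⟩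
    · rintro m (_ | ⟨_, hm⟩)
      exacts [Set.mem_insert _ _, Set.mem_insert_of_mem _ (ht.mem_bound m hm)]
    · rintro m (_ | ⟨_, hm⟩)
      exacts [Set.mem_insert _ _, Set.mem_insert_of_mem _ (ht.mem_freeW m hm)]
    -- Later `w` indices differ from `l` because `l` is not free in the scope; a later occurrence of
    -- `z` is a nested quantification.
    · refine List.pairwise_cons.2 ⟨fun m hm => ⟨?_, fun e => .inl ⟨rfl, ?_⟩⟩,
        ht.pairwise.imp fun ⟨h₁, h₂⟩ => ⟨h₁, fun e => .inr (h₂ e)⟩⟩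
      · rintro rfl
        exact hc.1 (ht.mem_freeW m hm)
      · exact (show z = m.1 from e) ▸ ht.mem_bound m hm
    · rintro A B H K β β' α α' ⟨-, a, b, hβ, hβ', hα⟩
      simp only [Sat, hβ, hβ', Option.some.injEq, exists_eq_left']
      exact h H K β β' _ _ hα

end NonCounting

/-! ### From Duplicator's bijection to logical equivalence. -/

theorem compatible_empty (H : SimpleGraph A) (K : SimpleGraph B) :
    Compatible (k₁ := k₁) (k₂ := k₂) H K (fun _ => none) fun _ => none :=
  ⟨fun _ => by simp, by rintro _ _ _ _ ⟨_, h, -⟩; cases h⟩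

theorem compatible_after {H : SimpleGraph A} {K : SimpleGraph B} {n : ℕ}
    {z : Fin n → Pebble k₁ k₂} {v : Fin n → A} {d : Fin n → B}
    (h : ∀ i, IsPartialIso H K (eta z v d i)) (i : ℕ) (hi : i ≤ n) :
    Compatible H K (Position.after (fun _ => none) (placements z v) i)
      (Position.after (fun _ => none) (placements z d) i) := by
  cases i with
  | zero =>
    simp only [Position.after_zero]
    exact compatible_empty H K
  | succ i =>
    have hA := after_placements_eq_some_iff z v ⟨i, hi⟩
    have hB := after_placements_eq_some_iff z d ⟨i, hi⟩
    constructor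
    · intro p
      rw [← not_iff_not, ← ne_eq, ← ne_eq, Option.ne_none_iff_exists', Option.ne_none_iff_exists']
      constructor
      · rintro ⟨a, ha⟩
        obtain ⟨j, hj, -⟩ := (hA p a).1 ha
        exact ⟨d j, (hB p _).2 ⟨j, hj, rfl⟩⟩
      · rintro ⟨a, ha⟩
        obtain ⟨j, hj, -⟩ := (hB p a).1 ha
        exact ⟨v j, (hA p _).2 ⟨j, hj, rfl⟩⟩
    · have aux : ∀ a b, (∃ p, Position.after (fun _ => none) (placements z v) (i + 1) p = some a ∧
          Position.after (fun _ => none) (placements z d) (i + 1) p = some b) →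
          eta z v d ⟨i, hi⟩ a b := by
        rintro a b ⟨p, ha, hb⟩
        obtain ⟨j, hj, rfl⟩ := (hA p a).1 ha
        obtain ⟨j', hj', rfl⟩ := (hB p b).1 hb
        have : j = j' := by
          rcases lt_trichotomy j j' with hlt | heq | hlt
          · exact absurd hj'.1 (hj.2.2 j' hlt hj'.2.1)
          · exact heq
          · exact absurd hj.1 (hj'.2.2 j hlt hj.2.1)
        exact ⟨p, j, hj, rfl, this ▸ rfl⟩
      exact fun a b a' b' hab hab' => h ⟨i, hi⟩ a b a' b' (aux a b hab) (aux a' b' hab')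

theorem compatibleAlong_of_compatible_after {H : SimpleGraph A} {K : SimpleGraph B}
    {β : ℕ → Option A} {β' : ℕ → Option B} {t : List (Pebble k₁ k₂ × ℕ)}
    {α : Pebble k₁ k₂ → Option A} {α' : Pebble k₁ k₂ → Option B}
    (hβ : ∀ m ∈ t, ∃ a b, β m.2 = some a ∧ β' m.2 = some b)
    (h : ∀ i ≤ t.length, Compatible H K (Position.after α (t.map fun m => (m.1, β m.2)) i)
      (Position.after α' (t.map fun m => (m.1, β' m.2)) i)) :
    CompatibleAlong H K β β' α α' t := by
  have h₀ := h 0 (Nat.zero_le _)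
  rw [Position.after_zero, Position.after_zero] at h₀
  induction t generalizing α α' with
  | nil => exact h₀
  | cons m t ih =>
    obtain ⟨a, b, ha, hb⟩ := hβ m (by simp)
    have h' : ∀ i ≤ t.length, Compatible H K
        (Position.after (Function.update α m.1 (some a)) (t.map fun m => (m.1, β m.2)) i)
        (Position.after (Function.update α' m.1 (some b)) (t.map fun m => (m.1, β' m.2)) i) := by
      intro i hi
      have := h (i + 1) (by simpa using hi)
      simpa only [List.map_cons, Position.after_cons_succ, ha, hb] using this
    refine ⟨h₀, a, b, ha, hb, ih (fun m hm => hβ m (List.mem_cons_of_mem _ hm)) h' ?_⟩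
    simpa only [Position.after_zero] using h' 0 (Nat.zero_le _)

/-- Equivalences of the tuples of length `n` and of the points extend along an injection. -/
theorem exists_equiv_comp {m n : ℕ} {e : Fin n → Fin m} (he : Function.Injective e)
    (h : (Fin n → A) ≃ (Fin n → B)) (g : A ≃ B) :
    ∃ F : (Fin m → A) ≃ (Fin m → B), ∀ v i, F v (e i) = h (v ∘ e) i := by
  classical
  let r := Equiv.ofInjective e he
  refine ⟨(Equiv.piEquivPiSubtypeProd (· ∈ Set.range e) fun _ => A).trans
    ((((r.arrowCongr (Equiv.refl A)).symm.trans
      (h.trans (r.arrowCongr (Equiv.refl B)))).prodCongr ((Equiv.refl _).arrowCongr g)).trans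
    (Equiv.piEquivPiSubtypeProd (· ∈ Set.range e) fun _ => B).symm), fun v i => ?_⟩
  have : r.symm ⟨e i, i, rfl⟩ = i := r.symm_apply_eq.2 rfl
  simp [Equiv.piEquivPiSubtypeProd, Equiv.arrowCongr, this]
  rfl

theorem DuplicatorWins.logicEquiv.{v} {A B : Type v} {H : SimpleGraph A} {K : SimpleGraph B}
    (hk : 0 < k₁ + k₂) (hD : DuplicatorWins k₁ k₂ H K) : LogicEquiv k₁ k₂ H K := by
  obtain ⟨z₀⟩ : Nonempty (Pebble k₁ k₂) := by
    rw [← Fintype.card_pos_iff]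
    simpa using hk
  -- A play with a single placement yields a bijection of the vertex sets, later used on counted
  -- coordinates off the trace. It needs a pebble to exist, hence `hk`.
  obtain ⟨g₁, -⟩ := hD 1 (fun _ => z₀) fun _ _ _ _ _ => Subsingleton.elim _ _
  let g : A ≃ B := (Equiv.funUnique (Fin 1) A).symm.trans (g₁.trans (Equiv.funUnique (Fin 1) B))
  intro φ hφ
  induction φ with
  | nc ψ =>
    obtain ⟨⟨hc, hd, -⟩, -, hw⟩ := hφ
    obtain ⟨t, ht, h⟩ := ψ.exists_trace hc hd
    have : t = [] := List.eq_nil_iff_forall_not_mem.2 fun m hm => by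
      simpa [hw] using ht.mem_freeW m hm
    subst this
    exact h H K _ _ _ _ (compatible_empty H K)
  | or φ φ' ih ih' => exact or_congr (ih hφ.1) (ih' hφ.2)
  | @count N m w ψ =>
    obtain ⟨⟨hc, hd, hr⟩, hw, -, hfw⟩ := hφ
    obtain ⟨t, ht, hdet⟩ := ψ.exists_trace hc hd
    -- `e` sends each quantification on the trace to the counted coordinate that its variable `w`
    -- names.
    choose e he using fun i : Fin t.length => hfw (ht.mem_freeW t[i] (List.getElem_mem _))
    have hpair := List.pairwise_iff_getElem.1 ht.pairwise
    have hinj : Function.Injective e := by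
      intro i j hij
      by_contra hne
      have h : t[i].2 = t[j].2 := by rw [← he, ← he, hij]
      rcases lt_or_gt_of_ne hne with hlt | hlt
      · exact (hpair i j i.2 j.2 hlt).1 h
      · exact (hpair j i j.2 i.2 hlt).1 h.symm
    -- The trace is a legal choice for Spoiler: a repeated $y_j$ would be a nested requantification,
    -- excluded by validity.
    obtain ⟨h, hh⟩ := hD t.length (fun i => t[i].1) fun y i j hi hj => by
      by_contra hne
      rcases lt_or_gt_of_ne hne with hlt | hlt
      · exact hr y (.inr (hi ▸ (hpair i j i.2 j.2 hlt).2 (hi.trans hj.symm)))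
      · exact hr y (.inr (hj ▸ (hpair j i j.2 i.2 hlt).2 (hj.trans hi.symm)))
    obtain ⟨F, hF⟩ := exists_equiv_comp hinj h g
    have hβ : ∀ {X : Type v} (v : Fin m → X) (i : Fin t.length),
        Function.extend w (fun i => some (v i)) (fun _ => none) t[i].2 = some (v (e i)) := by
      intro X v i
      rw [← he, hw.extend_apply]
    have hmap : ∀ {X : Type v} (v : Fin m → X),
        (t.map fun m => (m.1, Function.extend w (fun i => some (v i)) (fun _ => none) m.2)) =
          placements (fun i : Fin t.length => t[i].1) (v ∘ e) := by
      intro X v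
      refine List.ext_getElem (by simp [placements]) fun i h₁ h₂ => ?_
      have := hβ v ⟨i, by simpa using h₁⟩
      simpa [placements] using this
    have key : ∀ v : Fin m → A,
        ψ.Sat H (Function.extend w (fun i => some (v i)) (fun _ => none)) (fun _ => none) ↔
        ψ.Sat K (Function.extend w (fun i => some (F v i)) (fun _ => none)) (fun _ => none) := by
      intro v
      refine hdet H K _ _ _ _ (compatibleAlong_of_compatible_after (fun m hm => ?_) ?_)
      · obtain ⟨i, hi, rfl⟩ := List.getElem_of_mem hm
        exact ⟨_, _, hβ v ⟨i, hi⟩, hβ (F v) ⟨i, hi⟩⟩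
      · rw [hmap, hmap, show F v ∘ e = h (v ∘ e) from funext (hF v)]
        exact compatible_after (hh (v ∘ e))
    have hcard := Set.encard_congr (F.subtypeEquiv (p := (· ∈ {v : Fin m → A | ψ.Sat H
      (Function.extend w (fun i => some (v i)) (fun _ => none)) (fun _ => none)}))
      (q := (· ∈ {v : Fin m → B | ψ.Sat K
      (Function.extend w (fun i => some (v i)) (fun _ => none)) (fun _ => none)})) key)
    exact Eq.congr_left hcard

end Logic

end CFIGame

theorem mainTheorem8 {V : Type*} [Finite V] (G : SimpleGraph V) (hG : G.Connected)
    (k₁ k₂ : ℕ) (hk : 0 < k₁ + k₂) (hfug : CFIGame.FugitiveWins G k₁ k₂) (u : V) :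
    CFIGame.DuplicatorWins k₁ k₂ (CFIGame.cfiGraph G ∅) (CFIGame.cfiGraph G {u}) ∧
      CFIGame.LogicEquiv k₁ k₂ (CFIGame.cfiGraph G ∅) (CFIGame.cfiGraph G {u}) :=
  have hD := hfug.duplicatorWins hG u
  ⟨hD, hD.logicEquiv hk⟩
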